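/- All graphs are finite and simple. For points $a,b\in\mathbb{C}^2$ put $d(a,b)=(a_1-b_1)^2+(a_2-b_2)^2$. A complex (real) realisation of a graph $G=(V,E)$ is a map $p:V\to\mathbb{C}^2$ ($p:V\to\mathbb{R}^2$); it is generic if the $2|V|$ coordinates of the points $p(v)$, $v\in V$, are algebraically independent over $\mathbb{Q}$. Two realisations $p,q$ of $G$ are equivalent if $d(p(u),p(v))=d(q(u),q(v))$ for all $uv\in E$, and congruent if this holds for all $u,v\in V$. A real realisation $p$ is rigid if there is an $\epsilon>0$ such that every real realisation $q$ that is equivalent to $p$ and satisfies $\|p(v)-q(v)\|^2<\epsilon$ for all $v\in V$ is congruent to $p$; the graph $G$ is rigid if every (equivalently, some) generic real realisation of $G$ is rigid. For fields $K\subseteq L$, $L$ is a radical extension of $K$ if there are fields $K=K_1\subseteq K_2\subseteq\dots\subseteq K_t=L$ such that for each $1\le i<t$, $K_{i+1}=K_i(x_i)$ with $x_i^{n_i}\in K_i$ for some integer $n_i\ge 1$; it is a quadratic extension if this is possible with all $n_i=2$. The extension $L:K$ is radically (quadratically) solvable if $L$ is contained in a radical (quadratic) extension of $K$. For a complex realisation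 $q$ of $G$ let $\mathbb{Q}(q)$ be the field generated over $\mathbb{Q}$ by all coordinates of the points $q(v)$, and $\mathbb{Q}(d_G(q))$ the field generated over $\mathbb{Q}$ by all $d(q(u),q(v))$, $uv\in E$. A complex realisation $p$ of $G$ is radically (quadratically) solvable if there is a complex realisation $q$ congruent to $p$ such that $\mathbb{Q}(q):\mathbb{Q}(d_G(q))$ is radically (quadratically) solvable. A rigid graph $G$ is radically (quadratically) solvable if every (equivalently, some) generic complex realisation of $G$ is radically (quadratically) solvable. Lemma. Let $H_0,H_1,H_2$ be graphs with $V(H_0)\cap V(H_1)=V(H_0)\cap V(H_2)=V(H_1)\cap V(H_2)=U$, $|U|\ge 2$, and $E(H_0)\cap E(H_1)=E(H_0)\cap E(H_2)=\emptyset$. Let $G_1=H_0\cup H_1$ and $G_2=H_0\cup H_2$. Suppose that $G_1$ and $H_2$ are both rigid. Then: (a) $G_2$ is rigid. (b) If $G_1$ and $H_2$ are both radically solvable, then $G_2$ is radically solvable; if $G_1$ and $H_2$ are both quadratically solvable, then $G_2$ is quadratically solvable. -/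

import Mathlib

namespace Framework

section Realisations

variable {V : Type*} {F : Type*} [Field F]

/-- The squared distance `d(a, b) = (a₁ - b₁)² + (a₂ - b₂)²` of two points of the plane `F²`
(`F` is `ℝ` or `ℂ` below; over `ℂ` there is no complex conjugation in this expression). -/
def sqDist (a b : Fin 2 → F) : F := (a 0 - b 0) ^ 2 + (a 1 - b 1) ^ 2

/-- A realisation `p : V → F²` is generic if the family of all its coordinates (two for each
vertex) is algebraically independent over `ℚ`. -/
def IsGeneric [Algebra ℚ F] (p : V → Fin 2 → F) : Prop :=
  AlgebraicIndependent ℚ (fun i : V × Fin 2 => p i.1 i.2)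

/-- `(G, p)` and `(G, q)` are equivalent: all edges have the same squared length. -/
def Equivalent (G : SimpleGraph V) (p q : V → Fin 2 → F) : Prop :=
  ∀ u v : V, G.Adj u v → sqDist (p u) (p v) = sqDist (q u) (q v)

/-- `p` and `q` are congruent: all pairs of vertices have the same squared distance. -/
def Congruent (p q : V → Fin 2 → F) : Prop :=
  ∀ u v : V, sqDist (p u) (p v) = sqDist (q u) (q v)

end Realisations

section Rigidity

variable {V : Type*}

/-- The real framework `(G, p)` is rigid: every real framework that is equivalent and
sufficiently close to it is congruent to it. -/
def IsRigidFramework (G : SimpleGraph V) (p : V → Fin 2 → ℝ) : Prop :=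
  ∃ ε : ℝ, 0 < ε ∧ ∀ q : V → Fin 2 → ℝ,
    Equivalent G p q → (∀ v, sqDist (p v) (q v) < ε) → Congruent p q

/-- The graph `G` is rigid: every generic real realisation of `G` is rigid. -/
def IsRigid (G : SimpleGraph V) : Prop :=
  ∀ p : V → Fin 2 → ℝ, IsGeneric p → IsRigidFramework G p

end Rigidity

section Fields

/-- `T` is a tower `K = T 0, T 1, …, T t = L` of subfields of `ℂ` in which each field arises from
the previous one by adjoining an `n`-th root of one of its elements, for an exponent `n` (which
may vary with the step) that satisfies `P`. -/
def IsRootTower (P : ℕ → Prop) (K L : IntermediateField ℚ ℂ) (t : ℕ)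
    (T : ℕ → IntermediateField ℚ ℂ) : Prop :=
  T 0 = K ∧ T t = L ∧
    ∀ i < t, ∃ (x : ℂ) (n : ℕ), P n ∧ x ^ n ∈ T i ∧
      T (i + 1) = T i ⊔ IntermediateField.adjoin ℚ {x}

/-- `L` is a radical extension of `K`. -/
def IsRadicalExtension (K L : IntermediateField ℚ ℂ) : Prop :=
  ∃ t T, IsRootTower (fun n => 0 < n) K L t T

/-- `L` is a quadratic extension of `K`: a radical extension by square roots only. -/
def IsQuadraticExtension (K L : IntermediateField ℚ ℂ) : Prop :=
  ∃ t T, IsRootTower (fun n => n = 2) K L t T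

/-- The extension `L : K` is radically solvable: `L` is contained in a radical extension of `K`.
As radical extensions are algebraic and `ℂ` is algebraically closed, it makes no difference that
only radical extensions inside `ℂ` are considered. -/
def RadicallySolvableExtension (K L : IntermediateField ℚ ℂ) : Prop :=
  K ≤ L ∧ ∃ M, IsRadicalExtension K M ∧ L ≤ M

/-- The extension `L : K` is quadratically solvable: `L` is contained in a quadratic extension
of `K`. -/
def QuadraticallySolvableExtension (K L : IntermediateField ℚ ℂ) : Prop :=
  K ≤ L ∧ ∃ M, IsQuadraticExtension K M ∧ L ≤ M

end Fields

section Solvability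

variable {V : Type*}

/-- The field `ℚ(q)` generated by all coordinates of the complex realisation `q`. -/
noncomputable def coordField (q : V → Fin 2 → ℂ) : IntermediateField ℚ ℂ :=
  IntermediateField.adjoin ℚ {z | ∃ (v : V) (i : Fin 2), z = q v i}

/-- The field `ℚ(d_G(q))` generated by the squared edge lengths of the complex framework
`(G, q)`. -/
noncomputable def edgeField (G : SimpleGraph V) (q : V → Fin 2 → ℂ) : IntermediateField ℚ ℂ :=
  IntermediateField.adjoin ℚ {z | ∃ u v : V, G.Adj u v ∧ z = sqDist (q u) (q v)}

/-- The complex framework `(G, p)` is radically solvable: for some congruent realisation `q`, the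
extension `ℚ(q) : ℚ(d_G(q))` is radically solvable. -/
def RadicallySolvableFramework (G : SimpleGraph V) (p : V → Fin 2 → ℂ) : Prop :=
  ∃ q : V → Fin 2 → ℂ, Congruent p q ∧ RadicallySolvableExtension (edgeField G q) (coordField q)

/-- The complex framework `(G, p)` is quadratically solvable: for some congruent realisation `q`,
the extension `ℚ(q) : ℚ(d_G(q))` is quadratically solvable. -/
def QuadraticallySolvableFramework (G : SimpleGraph V) (p : V → Fin 2 → ℂ) : Prop :=
  ∃ q : V → Fin 2 → ℂ, Congruent p q ∧
    QuadraticallySolvableExtension (edgeField G q) (coordField q)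

/-- A graph is radically solvable if it is rigid and all its generic complex realisations are
radically solvable. -/
def IsRadicallySolvable (G : SimpleGraph V) : Prop :=
  IsRigid G ∧ ∀ p : V → Fin 2 → ℂ, IsGeneric p → RadicallySolvableFramework G p

/-- A graph is quadratically solvable if it is rigid and all its generic complex realisations are
quadratically solvable. -/
def IsQuadraticallySolvable (G : SimpleGraph V) : Prop :=
  IsRigid G ∧ ∀ p : V → Fin 2 → ℂ, IsGeneric p → QuadraticallySolvableFramework G p

end Solvability

end Framework

/-!
Let `G₁ = H₀ ∪ H₁` and `G₂ = H₀ ∪ H₂`, glued along a set containing two distinct vertices `a`, `b`.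
For a realisation with `d(a, b) ≠ 0`, the position of a further vertex `v` is recorded by the
polynomials `frameInner` and `frameDet`, its coordinates in the frame with origin `a` and first axis
`b - a`, up to a common scaling. Squared distances determine the first coordinate and the square of
the second one; conversely the relative coordinates and `d(a, b)` determine all squared distances.

**Rigidity** (`isRigid_sup_coe`). Extend a generic realisation of `G₂` to a generic one that
includes the vertices of `H₁`. A small deformation of `G₂` preserves the distances within `H₂`, and
by continuity the signs of `frameDet`, so it preserves the relative coordinates of the vertices of
`H₂`. Letting the remaining vertices of `H₁` keep their relative coordinates gives a small
deformation of `G₁`, which preserves the distances within `H₀` because `G₁` is rigid. So the relative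
coordinates of all vertices of `G₂` are preserved.

**Solvability** (`solvableFramework_sup_coe`). Radical and quadratic solvability are treated
together: `P` is the condition on the exponents of the roots, and `radClosure P K` is the closure
of the field `K` under such roots. A framework is solvable if and only if all its squared distances
lie in the closure of the field of edge lengths (`solvableFramework_iff`). Let `C` be this closure
for `G₂`. It contains the relative coordinates of all vertices of `H₂`. The relative coordinates `ξ`
of the other vertices of `H₁` are algebraically independent over a field `A` that contains `C` and
the realisation of `H₀`. Solvability of `G₁` says that the squared distances within `H₀` are
obtained by roots from `C(ξ)`. These distances lie in `A`, and the descent lemma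
`mem_of_mem_radClosure_sup_adjoin` puts them into `C`.

The descent lemma is proved without Galois theory: specialising `ξ` to a sufficiently general point
of an ultrapower `C*` of `C` embeds the algebraic closure of `A(ξ)` into the ultrapower `ℂ*`, in
which `C*` is closed under roots, so that everything obtained by roots from `C(ξ)` lands in `C*`;
the constants of `C*` are the elements of `C`.
-/

namespace Framework

/-! ### Closure under roots -/

section RadClosure

variable {P : ℕ → Prop}

/-- A subfield of `ℂ` is closed under `P`-roots if it contains every `n`-th root of each of its
elements, for all exponents `n` satisfying `P`. -/
def IsRootClosed (P : ℕ → Prop) (L : IntermediateField ℚ ℂ) : Prop :=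
  ∀ (x : ℂ) (n : ℕ), P n → x ^ n ∈ L → x ∈ L

/-- The smallest subfield of `ℂ` that contains `K` and is closed under `P`-roots. -/
noncomputable def radClosure (P : ℕ → Prop) (K : IntermediateField ℚ ℂ) : IntermediateField ℚ ℂ :=
  sInf {L | K ≤ L ∧ IsRootClosed P L}

theorem le_radClosure (K : IntermediateField ℚ ℂ) : K ≤ radClosure P K :=
  le_sInf fun _ hL => hL.1

theorem isRootClosed_radClosure (K : IntermediateField ℚ ℂ) :
    IsRootClosed P (radClosure P K) := by
  intro x n hn hx
  simp only [radClosure, IntermediateField.mem_sInf] at hx ⊢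
  exact fun L hL => hL.2 x n hn (hx L hL)

theorem radClosure_le {K L : IntermediateField ℚ ℂ} (hKL : K ≤ L) (hL : IsRootClosed P L) :
    radClosure P K ≤ L :=
  sInf_le ⟨hKL, hL⟩

theorem radClosure_mono {K L : IntermediateField ℚ ℂ} (h : K ≤ L) :
    radClosure P K ≤ radClosure P L :=
  radClosure_le (h.trans (le_radClosure L)) (isRootClosed_radClosure L)

/-- One step of a root tower: `L` arises from `K` by adjoining an `n`-th root of an element. -/
def RootStep (P : ℕ → Prop) (K L : IntermediateField ℚ ℂ) : Prop :=
  ∃ (x : ℂ) (n : ℕ), P n ∧ x ^ n ∈ K ∧ L = K ⊔ IntermediateField.adjoin ℚ {x}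

theorem exists_isRootTower_iff {K L : IntermediateField ℚ ℂ} :
    (∃ t T, IsRootTower P K L t T) ↔ Relation.ReflTransGen (RootStep P) K L := by
  constructor
  · rintro ⟨t, T, h0, ht, hs⟩
    have key : ∀ i ≤ t, Relation.ReflTransGen (RootStep P) K (T i) := by
      intro i
      induction i with
      | zero => intro _; rw [h0]
      | succ i ih => intro hi; exact (ih (by omega)).tail (hs i (by omega))
    exact ht ▸ key t le_rfl
  · intro h
    induction h with
    | refl => exact ⟨0, fun _ => K, rfl, rfl, by simp⟩
    | @tail M N _ hstep ih =>
      obtain ⟨t, T, h0, ht, hs⟩ := ih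
      refine ⟨t + 1, fun i => if i ≤ t then T i else N, by simp [h0], by simp, ?_⟩
      intro i hi
      rcases (Nat.lt_succ_iff.1 hi).lt_or_eq with hlt | rfl
      · simpa [hlt.le, Nat.succ_le_of_lt hlt] using hs i hlt
      · simpa [ht, RootStep] using hstep

theorem le_of_reflTransGen_rootStep {K L : IntermediateField ℚ ℂ}
    (h : Relation.ReflTransGen (RootStep P) K L) : K ≤ L := by
  induction h with
  | refl => exact le_rfl
  | tail _ hstep ih =>
    obtain ⟨x, n, -, -, rfl⟩ := hstep
    exact ih.trans le_sup_left

theorem le_radClosure_of_reflTransGen_rootStep {K L : IntermediateField ℚ ℂ}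
    (h : Relation.ReflTransGen (RootStep P) K L) : L ≤ radClosure P K := by
  induction h with
  | refl => exact le_radClosure K
  | tail _ hstep ih =>
    obtain ⟨x, n, hn, hx, rfl⟩ := hstep
    refine sup_le ih (IntermediateField.adjoin_le_iff.2 (Set.singleton_subset_iff.2 ?_))
    exact isRootClosed_radClosure K x n hn (ih hx)

/-- Two root towers over `K` have a common extension that is again a root tower over `K`. -/
theorem reflTransGen_rootStep_sup {K L M : IntermediateField ℚ ℂ}
    (hL : Relation.ReflTransGen (RootStep P) K L) (hM : Relation.ReflTransGen (RootStep P) K M) :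
    Relation.ReflTransGen (RootStep P) K (L ⊔ M) := by
  have h : Relation.ReflTransGen (RootStep P) (L ⊔ K) (L ⊔ M) :=
    hM.lift (L ⊔ ·) (by
      rintro A _ ⟨x, n, hn, hx, rfl⟩
      exact ⟨x, n, hn, (le_sup_right : A ≤ L ⊔ A) hx, sup_assoc _ _ _ |>.symm⟩)
  rw [sup_eq_left.2 (le_of_reflTransGen_rootStep hL)] at h
  exact hL.trans h

/-- Every element of the closure lies in a root tower, as the elements of root towers over `K` form a
field that is closed under `P`-roots. -/
theorem exists_reflTransGen_of_mem_radClosure {K : IntermediateField ℚ ℂ} {z : ℂ}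
    (hz : z ∈ radClosure P K) :
    ∃ M, Relation.ReflTransGen (RootStep P) K M ∧ z ∈ M := by
  let D : IntermediateField ℚ ℂ :=
    { carrier := {z | ∃ M, Relation.ReflTransGen (RootStep P) K M ∧ z ∈ M}
      mul_mem' := by
        rintro a b ⟨M, hM, ha⟩ ⟨N, hN, hb⟩
        exact ⟨M ⊔ N, reflTransGen_rootStep_sup hM hN,
          mul_mem ((le_sup_left : M ≤ M ⊔ N) ha) ((le_sup_right : N ≤ M ⊔ N) hb)⟩
      add_mem' := by
        rintro a b ⟨M, hM, ha⟩ ⟨N, hN, hb⟩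
        exact ⟨M ⊔ N, reflTransGen_rootStep_sup hM hN,
          add_mem ((le_sup_left : M ≤ M ⊔ N) ha) ((le_sup_right : N ≤ M ⊔ N) hb)⟩
      algebraMap_mem' := fun r => ⟨K, .refl, K.algebraMap_mem r⟩
      inv_mem' := by
        rintro a ⟨M, hM, ha⟩
        exact ⟨M, hM, inv_mem ha⟩ }
  refine radClosure_le (L := D) (fun x hx => ⟨K, .refl, hx⟩) ?_ hz
  rintro x n hn ⟨M, hM, hx⟩
  exact ⟨_, hM.tail ⟨x, n, hn, hx, rfl⟩, (le_sup_right : _ ≤ M ⊔ IntermediateField.adjoin ℚ {x})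
    (IntermediateField.mem_adjoin_simple_self ℚ x)⟩

/-- For finitely generated fields, being contained in a root tower over `K` is the same as being
contained in the closure of `K` under roots. -/
theorem exists_isRootTower_adjoin_le_iff {K : IntermediateField ℚ ℂ} {S : Set ℂ}
    (hS : S.Finite) :
    (∃ M, (∃ t T, IsRootTower P K M t T) ∧ IntermediateField.adjoin ℚ S ≤ M) ↔
      S ⊆ radClosure P K := by
  constructor
  · rintro ⟨M, hM, hSM⟩
    exact (IntermediateField.adjoin_le_iff.1 hSM).trans
      (le_radClosure_of_reflTransGen_rootStep (exists_isRootTower_iff.1 hM))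
  · intro h
    simp only [exists_isRootTower_iff, IntermediateField.adjoin_le_iff]
    induction S, hS using Set.Finite.induction_on with
    | empty => exact ⟨K, .refl, by simp⟩
    | @insert a S _ _ ih =>
      obtain ⟨M, hM, hSM⟩ := ih ((Set.subset_insert a S).trans h)
      obtain ⟨N, hN, ha⟩ := exists_reflTransGen_of_mem_radClosure (h (Set.mem_insert a S))
      refine ⟨M ⊔ N, reflTransGen_rootStep_sup hM hN, Set.insert_subset ?_ ?_⟩
      · exact (le_sup_right : N ≤ M ⊔ N) ha
      · exact hSM.trans (le_sup_left : M ≤ M ⊔ N)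

end RadClosure

/-! ### Descent along a purely transcendental extension -/

section Descent

/-- An ultrapower of an algebraically closed field is algebraically closed: roots of monic
polynomials are found componentwise. -/
theorem isAlgClosed_germ {X : Type*} (φ : Ultrafilter X) {k : Type*} [Field k] [IsAlgClosed k] :
    IsAlgClosed (Filter.Germ (φ : Filter X) k) := by
  refine IsAlgClosed.of_exists_root _ fun p hp hirr => ?_
  have hdeg : p.natDegree ≠ 0 := hirr.natDegree_pos.ne'
  have hc : ∀ j, ∃ f : X → k, (f : Filter.Germ (φ : Filter X) k) = p.coeff j := fun j =>
    (p.coeff j).inductionOn fun f => ⟨f, rfl⟩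
  choose γ hγ using hc
  have hroot : ∀ c : X, ∃ z : k,
      z ^ p.natDegree + ∑ j ∈ Finset.range p.natDegree, γ j c * z ^ j = 0 := by
    intro c
    let q : Polynomial k := Polynomial.X ^ p.natDegree +
      ∑ j ∈ Finset.range p.natDegree, Polynomial.C (γ j c) * Polynomial.X ^ j
    have hq : q.degree ≠ 0 := by
      have hlt : (∑ j ∈ Finset.range p.natDegree,
          Polynomial.C (γ j c) * Polynomial.X ^ j).degree < (p.natDegree : WithBot ℕ) := by
        refine (Polynomial.degree_sum_le _ _).trans_lt ((Finset.sup_lt_iff ?_).2 ?_)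
        · exact WithBot.bot_lt_coe _
        · intro j hj
          exact (Polynomial.degree_C_mul_X_pow_le _ _).trans_lt
            (by exact_mod_cast Finset.mem_range.1 hj)
      rw [Polynomial.degree_add_eq_left_of_degree_lt (by rwa [Polynomial.degree_X_pow]),
        Polynomial.degree_X_pow]
      exact_mod_cast hdeg
    obtain ⟨z, hz⟩ := IsAlgClosed.exists_root q hq
    refine ⟨z, ?_⟩
    simpa [q, Polynomial.IsRoot, Polynomial.eval_finsetSum] using hz
  choose z hz using hroot
  refine ⟨(z : Filter.Germ (φ : Filter X) k), ?_⟩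
  rw [Polynomial.eval_eq_sum_range, Finset.sum_range_succ, hp.coeff_natDegree, one_mul, add_comm]
  have h0 : (fun c => z c ^ p.natDegree + ∑ j ∈ Finset.range p.natDegree, γ j c * z c ^ j) =
      (z ^ p.natDegree + ∑ j ∈ Finset.range p.natDegree, γ j * z ^ j : X → k) := by
    ext c; simp
  have h1 := congrArg (Filter.Germ.coeRingHom (R := k) (φ : Filter X)) (h0.symm.trans (funext hz))
  have h2 : Filter.Germ.coeRingHom (R := k) (φ : Filter X) (fun _ => 0) = 0 :=
    map_zero (Filter.Germ.coeRingHom (R := k) (φ : Filter X))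
  rw [h2, map_add, map_sum, map_pow] at h1
  simp only [map_mul, map_pow] at h1
  simpa [← hγ] using h1

/-- There is an ultrafilter on the `C`-points of affine space that contains the nonvanishing set of
every nonzero polynomial, for an infinite subring `C`. -/
theorem exists_ultrafilter_ne_zero {R ι : Type*} [CommRing R] [IsDomain R] (C : Set R)
    (hC : C.Infinite) :
    ∃ φ : Ultrafilter (ι → C), ∀ f : MvPolynomial ι R, f ≠ 0 →
      ∀ᶠ c in (φ : Filter (ι → C)), MvPolynomial.eval (fun i => (c i : R)) f ≠ 0 := by
  let F : {f : MvPolynomial ι R // f ≠ 0} → Filter (ι → C) := fun f =>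
    Filter.principal {c | MvPolynomial.eval (fun i => (c i : R)) f.1 ≠ 0}
  have hdir : Directed (· ≥ ·) F := by
    intro f g
    refine ⟨⟨f.1 * g.1, mul_ne_zero f.2 g.2⟩, ?_, ?_⟩ <;>
    · refine Filter.principal_mono.2 fun c hc => ?_
      simp only [Set.mem_ofPred_eq, map_mul] at hc ⊢
      first | exact left_ne_zero_of_mul hc | exact right_ne_zero_of_mul hc
  have : Nonempty {f : MvPolynomial ι R // f ≠ 0} := ⟨⟨1, one_ne_zero⟩⟩
  obtain ⟨c₀, hc₀⟩ := hC.nonempty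
  have : Nonempty (ι → C) := ⟨fun _ => ⟨c₀, hc₀⟩⟩
  have : (⨅ f, F f).NeBot := by
    refine Filter.iInf_neBot_of_directed hdir fun f => Filter.principal_neBot_iff.2 ?_
    by_contra hne
    refine f.2 (MvPolynomial.funext_set (fun _ => C) (fun _ => hC) fun x hx => ?_)
    by_contra hx0
    exact hne ⟨fun i => ⟨x i, hx i trivial⟩, by simpa using hx0⟩
  refine ⟨Ultrafilter.of (⨅ f, F f), fun f hf => ?_⟩
  exact (Ultrafilter.of_le _).trans (iInf_le F ⟨f, hf⟩) (Filter.mem_principal_self _)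

/-- Let a domain `R` embed into a field `K` and into an algebraically closed field `Ω`. The second
embedding extends to the relative algebraic closure of `R` in `K`. -/
theorem exists_ringHom_extending {R K Ω : Type*} [CommRing R] [IsDomain R] [Field K] [Field Ω]
    [IsAlgClosed Ω] {f : R →+* K} (hf : Function.Injective f) {g : R →+* Ω}
    (hg : Function.Injective g) :
    ∃ (S : Subfield K) (ψ : S →+* Ω), (∀ (x : K) (n : ℕ), 0 < n → x ^ n ∈ S → x ∈ S) ∧
      ∀ r, ∃ h : f r ∈ S, ψ ⟨f r, h⟩ = g r := by
  let _ : Algebra R K := f.toAlgebra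
  let _ : Algebra R Ω := g.toAlgebra
  have : FaithfulSMul R K := (faithfulSMul_iff_algebraMap_injective R K).2 hf
  have : FaithfulSMul R Ω := (faithfulSMul_iff_algebraMap_injective R Ω).2 hg
  let S := Subalgebra.algebraicClosure R K
  let ψ : S →ₐ[R] Ω := IsAlgClosed.lift
  exact ⟨{ S.toSubring with inv_mem' := fun x hx => IsAlgebraic.inv hx }, ψ.toRingHom,
    fun x n hn hx => IsAlgebraic.of_pow hn hx, fun r => ⟨S.algebraMap_mem r, ψ.commutes r⟩⟩

/-- The elements of an ultrapower that are represented by functions with values in the subfield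
`C`. -/
def germSubfield {X k : Type*} [Field k] (φ : Ultrafilter X) (C : Subfield k) :
    Subfield (Filter.Germ (φ : Filter X) k) where
  carrier := {g | ∃ f : X → k, (∀ c, f c ∈ C) ∧ (f : Filter.Germ (φ : Filter X) k) = g}
  mul_mem' := by
    rintro _ _ ⟨f, hf, rfl⟩ ⟨g, hg, rfl⟩
    exact ⟨f * g, fun c => mul_mem (hf c) (hg c), rfl⟩
  add_mem' := by
    rintro _ _ ⟨f, hf, rfl⟩ ⟨g, hg, rfl⟩
    exact ⟨f + g, fun c => add_mem (hf c) (hg c), rfl⟩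
  neg_mem' := by
    rintro _ ⟨f, hf, rfl⟩
    exact ⟨-f, fun c => neg_mem (hf c), rfl⟩
  inv_mem' := by
    rintro _ ⟨f, hf, rfl⟩
    exact ⟨f⁻¹, fun c => inv_mem (hf c), rfl⟩
  one_mem' := ⟨1, fun _ => one_mem C, rfl⟩
  zero_mem' := ⟨0, fun _ => zero_mem C, rfl⟩

theorem mem_germSubfield_of_pow_mem {X k : Type*} [Field k] {φ : Ultrafilter X} {C : Subfield k}
    {n : ℕ} (hC : ∀ x : k, x ^ n ∈ C → x ∈ C) {g : Filter.Germ (φ : Filter X) k}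
    (hg : g ^ n ∈ germSubfield φ C) : g ∈ germSubfield φ C := by
  classical
  induction g using Filter.Germ.inductionOn with
  | h g =>
  obtain ⟨f, hf, hfg⟩ := hg
  refine ⟨fun c => if g c ∈ C then g c else 0, fun c => ?_, Filter.Germ.coe_eq.2 ?_⟩
  · dsimp only
    split_ifs with h
    exacts [h, zero_mem C]
  · filter_upwards [Filter.Germ.coe_eq.1 hfg] with c hc
    have : g c ∈ C := hC (g c) (by have := hf c; rwa [hc] at this)
    simp [this]

/-- Let `C ≤ A` be subfields of `ℂ`, let `C` be closed under `P`-roots and let `ξ` be algebraically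
independent over `A`. An element of `A` that is obtained from `C(ξ)` by `P`-roots already lies
in `C`.

Sending `ξ` to a point of the ultrapower `C*` at which no nonzero polynomial over `A` vanishes
embeds `A(ξ)`, and then its algebraic closure, into `ℂ*`. As `C*` is closed under `P`-roots in
`ℂ*`, everything obtained from `C(ξ)` by roots lands in `C*`, and a constant of `C*` lies in `C`. -/
theorem mem_of_mem_radClosure_sup_adjoin {P : ℕ → Prop} (hP : ∀ n, P n → 0 < n)
    {A C : IntermediateField ℚ ℂ} (hCA : C ≤ A) (hC : IsRootClosed P C) {ι : Type*} {ξ : ι → ℂ}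
    (hξ : AlgebraicIndependent A ξ) {z : ℂ} (hzA : z ∈ A)
    (hz : z ∈ radClosure P (C ⊔ IntermediateField.adjoin ℚ (Set.range ξ))) : z ∈ C := by
  let C' : Set A := {a | (a : ℂ) ∈ C}
  have hC' : C'.Infinite := by
    refine Set.infinite_of_injective_forall_mem (f := fun n : ℕ => (n : A)) Nat.cast_injective ?_
    intro n
    simp [C']
  obtain ⟨φ, hφ⟩ := exists_ultrafilter_ne_zero (ι := ι) C' hC'
  let Ω := Filter.Germ (φ : Filter (ι → C')) ℂ
  have hΩ : IsAlgClosed Ω := isAlgClosed_germ φ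
  -- evaluation at `ξ` in `ℂ`, and at the tautological point of `C*` in the ultrapower
  let evξ : MvPolynomial ι A →+* ℂ := (MvPolynomial.aeval ξ).toRingHom
  let evΩ : MvPolynomial ι A →+* Ω :=
    (Filter.Germ.coeRingHom (R := ℂ) (φ : Filter (ι → C'))).comp
      (RingHom.pi fun c => (algebraMap A ℂ).comp (MvPolynomial.eval fun i => (c i : A)))
  have hevΩ : Function.Injective evΩ := by
    rw [injective_iff_map_eq_zero]
    intro f hf
    by_contra hf0
    have h1 : ∀ᶠ c in (φ : Filter (ι → C')),
        (algebraMap A ℂ) (MvPolynomial.eval (fun i => (c i : A)) f) = 0 := Filter.Germ.coe_eq.1 hf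
    obtain ⟨c, hc, hc'⟩ := (h1.and (hφ f hf0)).exists
    exact hc' ((algebraMap A ℂ).injective (by rw [hc, map_zero]))
  obtain ⟨S, ψ, hS, hψ⟩ := exists_ringHom_extending (f := evξ) hξ hevΩ
  have hA : ∀ a : A, ∃ h : (a : ℂ) ∈ S, ψ ⟨a, h⟩ = ((fun _ => (a : ℂ) : (ι → C') → ℂ) : Ω) := by
    intro a
    have h := hψ (MvPolynomial.C a)
    have h1 : evξ (MvPolynomial.C a) = (a : ℂ) := by simp [evξ]
    have h2 : evΩ (MvPolynomial.C a) = ((fun _ => (a : ℂ) : (ι → C') → ℂ) : Ω) :=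
      congrArg (fun f : (ι → C') → ℂ => (f : Ω)) (funext fun c => by simp)
    rwa [h1, h2] at h
  -- the internal field `C*`, pulled back to `ℂ`
  let D' : Subfield ℂ := ((germSubfield φ C.toSubfield).comap ψ).map S.subtype
  have hD' : ∀ x, x ∈ D' ↔ ∃ h : x ∈ S, ψ ⟨x, h⟩ ∈ germSubfield φ C.toSubfield := by
    intro x
    simp [D', Subfield.mem_map]
  have hCD : ∀ x ∈ C, x ∈ D' := fun x hx => by
    obtain ⟨h, hh⟩ := hA ⟨x, hCA hx⟩
    exact (hD' x).2 ⟨h, _, fun _ => hx, hh.symm⟩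
  let D : IntermediateField ℚ ℂ := D'.toIntermediateField fun r => hCD _ (C.algebraMap_mem r)
  have hξD : ∀ i, ξ i ∈ D := fun i => by
    have h := hψ (MvPolynomial.X i)
    have h1 : evξ (MvPolynomial.X i) = ξ i := by simp [evξ]
    have h2 : evΩ (MvPolynomial.X i) = ((fun c => (c i : ℂ) : (ι → C') → ℂ) : Ω) :=
      congrArg (fun f : (ι → C') → ℂ => (f : Ω)) (funext fun c => by simp)
    rw [h1, h2] at h
    obtain ⟨h, hh⟩ := h
    exact (hD' _).2 ⟨h, _, fun c => (c i).2, hh.symm⟩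
  have hD : IsRootClosed P D := by
    intro x n hn hx
    obtain ⟨hxn, hψx⟩ := (hD' _).1 hx
    have hxS : x ∈ S := hS x n (hP n hn) hxn
    have hpow : ψ ⟨x ^ n, hxn⟩ = ψ ⟨x, hxS⟩ ^ n := map_pow ψ ⟨x, hxS⟩ n
    exact (hD' x).2 ⟨hxS, mem_germSubfield_of_pow_mem (fun y => hC y n hn) (hpow ▸ hψx)⟩
  have hzD : z ∈ D := by
    refine radClosure_le (sup_le hCD (IntermediateField.adjoin_le_iff.2 ?_)) hD hz
    rintro _ ⟨i, rfl⟩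
    exact hξD i
  obtain ⟨_, f, hf, hfz⟩ := (hD' z).1 hzD
  obtain ⟨_, hψz⟩ := hA ⟨z, hzA⟩
  obtain ⟨c, hc⟩ := (Filter.Germ.coe_eq.1 (hfz.trans hψz)).exists
  have : f c = z := hc
  exact this ▸ hf c

end Descent

/-! ### Generic realisations -/

section Generic

theorem countable_mvPolynomial {k ι : Type*} [CommRing k] [Countable k] [Countable ι] :
    Countable (MvPolynomial ι k) := by
  rw [← Cardinal.mk_le_aleph0_iff]
  refine MvPolynomial.cardinalMk_le_max_lift.trans (max_le (max_le ?_ ?_) le_rfl) <;> simp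

theorem exists_algebraicIndependent_of_countable {k L ι : Type*} [CommRing k] [Field L]
    [Algebra k L] [FaithfulSMul k L] [Countable k] [Uncountable L] [Countable ι] :
    ∃ x : ι → L, AlgebraicIndependent k x := by
  have : IsDomain k := (FaithfulSMul.algebraMap_injective k L).isDomain _
  obtain ⟨s, hs⟩ := exists_isTranscendenceBasis k L
  have hinf : Infinite s := by
    by_contra hfin
    rw [not_infinite_iff_finite] at hfin
    have halg := hs.isAlgebraic
    have := countable_mvPolynomial (k := k) (ι := s)
    have : Countable (Algebra.adjoin k (Set.range ((↑) : s → L))) :=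
      hs.1.aevalEquiv.symm.injective.countable
    have h := Algebraic.countable (Algebra.adjoin k (Set.range ((↑) : s → L))) L
    exact not_countable (α := L) (Set.countable_univ_iff.1 (h.mono fun x _ => halg.isAlgebraic x))
  obtain ⟨f, hf⟩ := exists_injective_nat ι
  exact ⟨_, hs.1.comp (fun i => Infinite.natEmbedding s (f i))
    ((Infinite.natEmbedding s).injective.comp hf)⟩

variable {F W : Type*} [Field F] [Algebra ℚ F]

theorem IsGeneric.comp {V V' : Type*} {p : V → Fin 2 → F} (hp : IsGeneric p) {f : V' → V}
    (hf : Function.Injective f) : IsGeneric fun v => p (f v) :=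
  AlgebraicIndependent.comp hp (fun i : V' × Fin 2 => (f i.1, i.2))
    fun i j h => by simpa [Prod.ext_iff, hf.eq_iff] using h

theorem IsGeneric.mono {S T : Set W} (h : S ⊆ T) {p : W → Fin 2 → F}
    (hp : IsGeneric fun v : T => p v) : IsGeneric fun v : S => p v :=
  IsGeneric.comp (p := fun v : T => p v) (f := Set.inclusion h) hp (Set.inclusion_injective h)

theorem IsGeneric.sqDist_ne_zero {V : Type*} {p : V → Fin 2 → F} (hp : IsGeneric p) {u v : V}
    (h : u ≠ v) : sqDist (p u) (p v) ≠ 0 := by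
  intro h0
  let f : MvPolynomial (V × Fin 2) ℚ :=
    (MvPolynomial.X (u, 0) - MvPolynomial.X (v, 0)) ^ 2 +
      (MvPolynomial.X (u, 1) - MvPolynomial.X (v, 1)) ^ 2
  have hf : f = 0 := AlgebraicIndependent.eq_zero_of_aeval_eq_zero hp f
    (by simpa [f, sqDist] using h0)
  classical
  have := congrArg (MvPolynomial.eval fun i => if i = (u, 0) then (1 : ℚ) else 0) hf
  simp [f, h.symm] at this

/-- A generic realisation of a finite vertex set extends to a generic realisation of any larger
finite vertex set, over an uncountable field. -/
theorem exists_isGeneric_extension [Uncountable F] {S T : Set W} (hS : S.Finite) (hT : T.Finite)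
    {p : S → Fin 2 → F} (hp : IsGeneric p) :
    ∃ p' : W → Fin 2 → F, (p = fun v : S => p' v) ∧ IsGeneric fun v : ↥(S ∪ T) => p' v := by
  classical
  have := hS.to_subtype
  have := hT.to_subtype
  let k := Algebra.adjoin ℚ (Set.range fun i : S × Fin 2 => p i.1 i.2)
  have : Countable (MvPolynomial (S × Fin 2) ℚ) := countable_mvPolynomial
  have hk : Countable k := (AlgebraicIndependent.aevalEquiv hp).symm.injective.countable
  obtain ⟨x, hx⟩ := exists_algebraicIndependent_of_countable (k := k) (L := F) (ι := T × Fin 2)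
  let p' : W → Fin 2 → F := fun v i =>
    if h : v ∈ S then p ⟨v, h⟩ i else if h : v ∈ T then x (⟨v, h⟩, i) else 0
  refine ⟨p', by ext v i; simp [p'], ?_⟩
  have h := AlgebraicIndependent.sumElim hp hx
  let e : ↥(S ∪ T) × Fin 2 → (T × Fin 2) ⊕ (S × Fin 2) := fun i =>
    if h : (i.1 : W) ∈ S then Sum.inr (⟨i.1, h⟩, i.2)
    else Sum.inl (⟨i.1, i.1.2.resolve_left h⟩, i.2)
  have he : Function.Injective e := by
    rintro ⟨⟨v, hv⟩, i⟩ ⟨⟨w, hw⟩, j⟩ hij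
    by_cases h1 : v ∈ S <;> by_cases h2 : w ∈ S <;> simp [e, h1, h2] at hij ⊢ <;> exact hij
  have hpe : (fun i : ↥(S ∪ T) × Fin 2 => p' i.1 i.2) =
      Sum.elim x (fun i : S × Fin 2 => p i.1 i.2) ∘ e := by
    ext ⟨⟨v, hv⟩, i⟩
    by_cases h1 : v ∈ S
    · simp [p', e, h1]
    · simp [p', e, h1, hv.resolve_left h1]
  rw [IsGeneric, hpe]
  exact h.comp e he

end Generic

/-! ### Coordinates relative to a pair of points -/

section Frame

variable {F : Type*} [Field F]

/-- The first coordinate of `c` in the orthogonal frame with origin `a` and first axis `b - a`,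
multiplied by `d(a, b)`. -/
def frameInner (a b c : Fin 2 → F) : F :=
  (b 0 - a 0) * (c 0 - a 0) + (b 1 - a 1) * (c 1 - a 1)

/-- The second coordinate of `c` in the orthogonal frame with origin `a` and first axis `b - a`,
multiplied by `d(a, b)`. -/
def frameDet (a b c : Fin 2 → F) : F :=
  (b 0 - a 0) * (c 1 - a 1) - (b 1 - a 1) * (c 0 - a 0)

/-- The point `c` with `frameInner a b c = x` and `frameDet a b c = y`, for `d(a, b) ≠ 0`. -/
def framePoint (a b : Fin 2 → F) (x y : F) : Fin 2 → F :=
  ![a 0 + ((b 0 - a 0) * x - (b 1 - a 1) * y) / sqDist a b,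
    a 1 + ((b 1 - a 1) * x + (b 0 - a 0) * y) / sqDist a b]

theorem frameInner_framePoint {a b : Fin 2 → F} (h : sqDist a b ≠ 0) (x y : F) :
    frameInner a b (framePoint a b x y) = x := by
  simp only [frameInner, framePoint, Matrix.cons_val_zero, Matrix.cons_val_one]
  field_simp
  simp only [sqDist]
  ring

theorem frameDet_framePoint {a b : Fin 2 → F} (h : sqDist a b ≠ 0) (x y : F) :
    frameDet a b (framePoint a b x y) = y := by
  simp only [frameDet, framePoint, Matrix.cons_val_zero, Matrix.cons_val_one]
  field_simp
  simp only [sqDist]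
  ring

theorem framePoint_frameInner_frameDet {a b : Fin 2 → F} (h : sqDist a b ≠ 0) (c : Fin 2 → F) :
    framePoint a b (frameInner a b c) (frameDet a b c) = c := by
  ext i
  fin_cases i <;>
  · simp only [framePoint, Fin.zero_eta, Fin.mk_one, Matrix.cons_val_zero, Matrix.cons_val_one]
    field_simp
    simp only [sqDist, frameInner, frameDet]
    ring

theorem sqDist_mul_sqDist (a b c d : Fin 2 → F) :
    sqDist a b * sqDist c d =
      (frameInner a b c - frameInner a b d) ^ 2 + (frameDet a b c - frameDet a b d) ^ 2 := by
  simp only [sqDist, frameInner, frameDet]; ring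

theorem two_mul_frameInner (a b c : Fin 2 → F) :
    2 * frameInner a b c = sqDist a b + sqDist a c - sqDist b c := by
  simp only [sqDist, frameInner]; ring

theorem frameDet_sq (a b c : Fin 2 → F) :
    frameDet a b c ^ 2 = sqDist a b * sqDist a c - frameInner a b c ^ 2 := by
  simp only [sqDist, frameInner, frameDet]; ring

theorem sqDist_eq_of_frame_eq {a b c d a' b' c' d' : Fin 2 → F} (h : sqDist a b ≠ 0)
    (hab : sqDist a b = sqDist a' b') (hc : frameInner a b c = frameInner a' b' c')
    (hd : frameInner a b d = frameInner a' b' d') (hc' : frameDet a b c = frameDet a' b' c')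
    (hd' : frameDet a b d = frameDet a' b' d') : sqDist c d = sqDist c' d' := by
  refine mul_left_cancel₀ h ?_
  rw [sqDist_mul_sqDist, hab, sqDist_mul_sqDist, hc, hd, hc', hd']

theorem frameInner_eq_of_sqDist_eq [CharZero F] {a b c a' b' c' : Fin 2 → F}
    (hab : sqDist a b = sqDist a' b') (hac : sqDist a c = sqDist a' c')
    (hbc : sqDist b c = sqDist b' c') : frameInner a b c = frameInner a' b' c' := by
  refine mul_left_cancel₀ (two_ne_zero (α := F)) ?_
  rw [two_mul_frameInner, two_mul_frameInner, hab, hac, hbc]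

theorem frameDet_sq_eq_of_sqDist_eq [CharZero F] {a b c a' b' c' : Fin 2 → F}
    (hab : sqDist a b = sqDist a' b') (hac : sqDist a c = sqDist a' c')
    (hbc : sqDist b c = sqDist b' c') : frameDet a b c ^ 2 = frameDet a' b' c' ^ 2 := by
  rw [frameDet_sq, frameDet_sq, frameInner_eq_of_sqDist_eq hab hac hbc, hab, hac]

end Frame

/-! ### Rigidity -/

section Rigidity

open Filter Topology

variable {V : Type*}

theorem isRigidFramework_iff_eventually [Finite V] {G : SimpleGraph V} {p : V → Fin 2 → ℝ} :
    IsRigidFramework G p ↔ ∀ᶠ q in 𝓝 p, Equivalent G p q → Congruent p q := by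
  constructor
  · rintro ⟨ε, hε, h⟩
    have : ∀ᶠ q in 𝓝 p, ∀ v, sqDist (p v) (q v) < ε := by
      refine eventually_all.2 fun v => ?_
      have hc : Continuous fun q : V → Fin 2 → ℝ => sqDist (p v) (q v) := by
        unfold sqDist; fun_prop
      exact hc.continuousAt.eventually_lt continuousAt_const (by simpa [sqDist] using hε)
    filter_upwards [this] with q hq hE using h q hE hq
  · intro h
    have := Fintype.ofFinite V
    obtain ⟨ε, hε, h⟩ := Metric.eventually_nhds_iff.1 h
    refine ⟨ε ^ 2, by positivity, fun q hE hq => h ?_ hE⟩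
    refine (dist_pi_lt_iff hε).2 fun v => (dist_pi_lt_iff hε).2 fun i => ?_
    have hv := hq v
    rw [Real.dist_eq, abs_sub_comm]
    refine abs_lt_of_sq_lt_sq ?_ hε.le
    refine lt_of_le_of_lt ?_ hv
    fin_cases i <;> simp only [sqDist, Fin.zero_eta, Fin.mk_one] <;>
      nlinarith [sq_nonneg (p v 0 - q v 0), sq_nonneg (p v 1 - q v 1)]

variable {W : Type*}

/-- Rigidity of a subgraph, in terms of realisations of the ambient vertex set with the product
topology. -/
theorem isRigidFramework_coe_iff {H : (⊤ : SimpleGraph W).Subgraph} (hfin : H.verts.Finite)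
    {p : W → Fin 2 → ℝ} :
    IsRigidFramework H.coe (fun v => p v) ↔ ∀ᶠ q in 𝓝 p,
      (∀ v w, H.Adj v w → sqDist (p v) (p w) = sqDist (q v) (q w)) →
        ∀ v ∈ H.verts, ∀ w ∈ H.verts, sqDist (p v) (p w) = sqDist (q v) (q w) := by
  classical
  have := hfin.to_subtype
  rw [isRigidFramework_iff_eventually]
  constructor
  · intro h
    have h2 : Tendsto (fun (q : W → Fin 2 → ℝ) (v : H.verts) => q v) (𝓝 p) (𝓝 fun v => p v) :=
      tendsto_pi_nhds.2 fun v => (continuous_apply (v : W)).tendsto p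
    filter_upwards [h2.eventually h] with q hq hE v hv w hw
    exact hq (fun v w hvw => hE v w hvw) ⟨v, hv⟩ ⟨w, hw⟩
  · intro h
    let e : (H.verts → Fin 2 → ℝ) → W → Fin 2 → ℝ := fun q w =>
      if h : w ∈ H.verts then q ⟨w, h⟩ else p w
    have he : ∀ (q : H.verts → Fin 2 → ℝ) (v : H.verts), e q v = q v := fun q v => by simp [e]
    have hep : e (fun v => p v) = p := by ext w i; simp [e]
    have hec : Continuous e := by
      refine continuous_pi fun w => ?_
      by_cases hw : w ∈ H.verts
      · simpa [e, hw] using continuous_apply _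
      · simpa [e, hw] using continuous_const
    filter_upwards [(hec.tendsto' _ _ hep).eventually h] with q hq hE v w
    have h2 := hq (fun v w hvw => by
      have h3 := hE ⟨v, hvw.fst_mem⟩ ⟨w, hvw.snd_mem⟩ hvw
      rwa [← he q, ← he q] at h3) v v.2 w w.2
    rwa [he, he] at h2

/-- Small deformations do not reverse orientations. -/
theorem eventually_frameDet_eq {S : Set W} (hS : S.Finite) (p : W → Fin 2 → ℝ) (a b : W) :
    ∀ᶠ q in 𝓝 p, ∀ v ∈ S, frameDet (p a) (p b) (p v) ^ 2 = frameDet (q a) (q b) (q v) ^ 2 →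
      frameDet (p a) (p b) (p v) = frameDet (q a) (q b) (q v) := by
  refine (eventually_all_finite hS).2 fun v _ => ?_
  by_cases h0 : frameDet (p a) (p b) (p v) = 0
  · refine Eventually.of_forall fun q h => ?_
    rw [h0, zero_pow two_ne_zero, eq_comm, sq_eq_zero_iff] at h
    rw [h0, h]
  · have hc : Continuous fun q : W → Fin 2 → ℝ =>
        frameDet (p a) (p b) (p v) * frameDet (q a) (q b) (q v) := by
      unfold frameDet; fun_prop
    filter_upwards [continuousAt_const.eventually_lt (hc.continuousAt (x := p))
      (mul_self_pos.2 h0)] with q hq h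
    rcases sq_eq_sq_iff_eq_or_eq_neg.1 h with h | h
    · exact h
    · rw [h] at hq
      nlinarith [sq_nonneg (frameDet (q a) (q b) (q v))]

open Classical in
/-- The realisation that agrees with `q` on `S`, while a vertex outside `S` keeps the position
relative to `q a` and `q b` that it has in `p` relative to `p a` and `p b`. -/
noncomputable def extendAlong (S : Set W) (p : W → Fin 2 → ℝ) (a b : W) (q : W → Fin 2 → ℝ) :
    W → Fin 2 → ℝ := fun w =>
  if w ∈ S then q w
  else framePoint (q a) (q b) (frameInner (p a) (p b) (p w)) (frameDet (p a) (p b) (p w))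

theorem extendAlong_of_mem {S : Set W} (p : W → Fin 2 → ℝ) (a b : W) (q : W → Fin 2 → ℝ) {w : W}
    (hw : w ∈ S) : extendAlong S p a b q w = q w :=
  if_pos hw

theorem extendAlong_of_notMem {S : Set W} (p : W → Fin 2 → ℝ) (a b : W) (q : W → Fin 2 → ℝ)
    {w : W} (hw : w ∉ S) : extendAlong S p a b q w =
      framePoint (q a) (q b) (frameInner (p a) (p b) (p w)) (frameDet (p a) (p b) (p w)) :=
  if_neg hw

theorem tendsto_extendAlong (S : Set W) {p : W → Fin 2 → ℝ} {a b : W}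
    (hab : sqDist (p a) (p b) ≠ 0) : Tendsto (extendAlong S p a b) (𝓝 p) (𝓝 p) := by
  refine tendsto_pi_nhds.2 fun w => ?_
  by_cases hw : w ∈ S
  · simp only [extendAlong_of_mem _ _ _ _ hw]
    exact (continuous_apply w).tendsto p
  · simp only [extendAlong_of_notMem _ _ _ _ hw]
    have hL : ContinuousAt (fun q : W → Fin 2 → ℝ => sqDist (q a) (q b)) p := by
      unfold sqDist; fun_prop
    nth_rewrite 3 [← framePoint_frameInner_frameDet hab (p w)]
    refine tendsto_pi_nhds.2 fun i => ?_
    fin_cases i <;>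
      simp only [framePoint, Fin.zero_eta, Fin.mk_one, Matrix.cons_val_zero, Matrix.cons_val_one]
    · have h : ContinuousAt (fun q : W → Fin 2 → ℝ => (q b 0 - q a 0) *
          frameInner (p a) (p b) (p w) - (q b 1 - q a 1) * frameDet (p a) (p b) (p w)) p := by
        fun_prop
      exact (continuous_apply_apply a 0).continuousAt.add (h.div hL hab)
    · have h : ContinuousAt (fun q : W → Fin 2 → ℝ => (q b 1 - q a 1) *
          frameInner (p a) (p b) (p w) + (q b 0 - q a 0) * frameDet (p a) (p b) (p w)) p := by
        fun_prop
      exact (continuous_apply_apply a 1).continuousAt.add (h.div hL hab)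

/-- In a rigid graph `H₀ ∪ H₁`, the part `H₁` may be replaced by any rigid graph `H₂` that contains
`V(H₀) ∩ V(H₁)`, provided that this set has at least two elements.

A small deformation of `H₀ ∪ H₂` moves `H₂` by a direct isometry. Moving `H₁` along by the same
isometry gives a small deformation of `H₀ ∪ H₁`, so `H₀` is moved by a direct isometry as well, and
the two isometries agree at two points. -/
theorem isRigid_sup_coe {H₀ H₁ H₂ : (⊤ : SimpleGraph W).Subgraph} (hfin₀ : H₀.verts.Finite)
    (hfin₁ : H₁.verts.Finite) (hfin₂ : H₂.verts.Finite) (hV : H₀.verts ∩ H₁.verts ⊆ H₂.verts)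
    {a b : W} (hab : a ≠ b) (ha₀ : a ∈ H₀.verts) (hb₀ : b ∈ H₀.verts) (ha₁ : a ∈ H₁.verts)
    (hb₁ : b ∈ H₁.verts) (hG₁ : IsRigid (H₀ ⊔ H₁).coe) (hH₂ : IsRigid H₂.coe) :
    IsRigid (H₀ ⊔ H₂).coe := by
  have hS : (H₀ ⊔ H₂).verts.Finite := hfin₀.union hfin₂
  intro p hp
  obtain ⟨p, rfl, hp'⟩ := exists_isGeneric_extension hS hfin₁ hp
  have ha : a ∈ (H₀ ⊔ H₂).verts := .inl ha₀
  have hb : b ∈ (H₀ ⊔ H₂).verts := .inl hb₀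
  have hL : sqDist (p a) (p b) ≠ 0 :=
    hp.sqDist_ne_zero (u := ⟨a, ha⟩) (v := ⟨b, hb⟩) (by simpa using hab)
  have hg₁ : IsGeneric fun v : (H₀ ⊔ H₁).verts => p v :=
    hp'.mono (Set.union_subset (fun v hv => .inl (.inl hv)) Set.subset_union_right)
  have hg₂ : IsGeneric fun v : H₂.verts => p v := hp.mono Set.subset_union_right
  have h₁ := (isRigidFramework_coe_iff (hfin₀.union hfin₁)).1 (hG₁ _ hg₁)
  have h₂ := (isRigidFramework_coe_iff hfin₂).1 (hH₂ _ hg₂)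
  rw [isRigidFramework_coe_iff hS]
  filter_upwards [h₂, (tendsto_extendAlong (H₀ ⊔ H₂).verts hL).eventually h₁,
    eventually_frameDet_eq hS p a b] with q h₂ h₁ hdet hq
  generalize hr : extendAlong (H₀ ⊔ H₂).verts p a b q = r at h₁
  have hrq : ∀ v ∈ (H₀ ⊔ H₂).verts, r v = q v := fun v hv =>
    hr ▸ extendAlong_of_mem p a b q hv
  have hra := hrq a ha
  have hrb := hrq b hb
  have hc₂ : ∀ v ∈ H₂.verts, ∀ w ∈ H₂.verts, sqDist (p v) (p w) = sqDist (q v) (q w) :=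
    h₂ fun v w hvw => hq v w (.inr hvw)
  have ha₂ : a ∈ H₂.verts := hV ⟨ha₀, ha₁⟩
  have hb₂ : b ∈ H₂.verts := hV ⟨hb₀, hb₁⟩
  have hab' : sqDist (p a) (p b) = sqDist (q a) (q b) := hc₂ a ha₂ b hb₂
  -- the vertices that have the same relative coordinates in `r` as in `p`
  let same : W → Prop := fun v =>
    frameInner (p a) (p b) (p v) = frameInner (q a) (q b) (r v) ∧
      frameDet (p a) (p b) (p v) = frameDet (q a) (q b) (r v)
  have hsame : ∀ v ∈ (H₀ ⊔ H₂).verts, sqDist (p a) (p v) = sqDist (q a) (q v) →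
      sqDist (p b) (p v) = sqDist (q b) (q v) → same v := by
    intro v hv hav hbv
    simp only [same, hrq v hv]
    exact ⟨frameInner_eq_of_sqDist_eq hab' hav hbv,
      hdet v hv (frameDet_sq_eq_of_sqDist_eq hab' hav hbv)⟩
  have hdist : ∀ v w, same v → same w → sqDist (p v) (p w) = sqDist (r v) (r w) :=
    fun v w hv hw => sqDist_eq_of_frame_eq hL hab' hv.1 hw.1 hv.2 hw.2
  have hs₂ : ∀ v ∈ H₂.verts, same v := fun v hv =>
    hsame v (.inr hv) (hc₂ a ha₂ v hv) (hc₂ b hb₂ v hv)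
  have hs₁ : ∀ v ∈ H₁.verts, same v := by
    intro v hv
    by_cases hvS : v ∈ (H₀ ⊔ H₂).verts
    · exact hs₂ v (hvS.elim (fun h => hV ⟨h, hv⟩) id)
    · have hv' : r v = framePoint (q a) (q b) _ _ := hr ▸ extendAlong_of_notMem p a b q hvS
      rw [hab'] at hL
      simp only [same, hv', frameInner_framePoint hL, frameDet_framePoint hL, and_self]
  have hc₁ := h₁ (by
    rintro v w (hvw | hvw)
    · rw [hrq v (.inl hvw.fst_mem), hrq w (.inl hvw.snd_mem)]
      exact hq v w (.inl hvw)
    · exact hdist v w (hs₁ v hvw.fst_mem) (hs₁ w hvw.snd_mem))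
  have hs : ∀ v ∈ (H₀ ⊔ H₂).verts, same v := by
    rintro v (hv | hv)
    · have hav := hc₁ a (.inl ha₀) v (.inl hv)
      have hbv := hc₁ b (.inl hb₀) v (.inl hv)
      rw [hra, hrq v (.inl hv)] at hav
      rw [hrb, hrq v (.inl hv)] at hbv
      exact hsame v (.inl hv) hav hbv
    · exact hs₂ v hv
  intro v hv w hw
  rw [hdist v w (hs v hv) (hs w hw), hrq v hv, hrq w hw]

end Rigidity

/-! ### Solvability -/

section Solvability

/-- The common form of radical and quadratic solvability: `P` is the condition on the exponents of
the roots that may be adjoined. The two notions are, by definition, the cases `fun n => 0 < n` and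
`fun n => n = 2`. -/
def SolvableFramework {V : Type*} (P : ℕ → Prop) (G : SimpleGraph V) (p : V → Fin 2 → ℂ) : Prop :=
  ∃ q : V → Fin 2 → ℂ, Congruent p q ∧ edgeField G q ≤ coordField q ∧
    ∃ M, (∃ t T, IsRootTower P (edgeField G q) M t T) ∧ coordField q ≤ M

theorem sqDist_mem {L : IntermediateField ℚ ℂ} {a b : Fin 2 → ℂ} (ha : ∀ i, a i ∈ L)
    (hb : ∀ i, b i ∈ L) : sqDist a b ∈ L :=
  add_mem (pow_mem (sub_mem (ha 0) (hb 0)) 2) (pow_mem (sub_mem (ha 1) (hb 1)) 2)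

theorem frameInner_mem {L : IntermediateField ℚ ℂ} {a b c : Fin 2 → ℂ} (hab : sqDist a b ∈ L)
    (hac : sqDist a c ∈ L) (hbc : sqDist b c ∈ L) : frameInner a b c ∈ L := by
  have h : frameInner a b c = (sqDist a b + sqDist a c - sqDist b c) / 2 := by
    rw [← two_mul_frameInner, mul_div_cancel_left₀ _ two_ne_zero]
  rw [h]
  exact div_mem (sub_mem (add_mem hab hac) hbc) (ofNat_mem L 2)

theorem frameDet_mem {P : ℕ → Prop} (h2 : P 2) {L : IntermediateField ℚ ℂ} (hL : IsRootClosed P L)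
    {a b c : Fin 2 → ℂ} (hab : sqDist a b ∈ L) (hac : sqDist a c ∈ L) (hbc : sqDist b c ∈ L) :
    frameDet a b c ∈ L := by
  refine hL _ 2 h2 ?_
  rw [frameDet_sq]
  exact sub_mem (mul_mem hab hac) (pow_mem (frameInner_mem hab hac hbc) 2)

theorem sqDist_mem_of_frame_mem {L : IntermediateField ℚ ℂ} {a b c d : Fin 2 → ℂ}
    (h0 : sqDist a b ≠ 0) (hab : sqDist a b ∈ L) (hc : frameInner a b c ∈ L)
    (hc' : frameDet a b c ∈ L) (hd : frameInner a b d ∈ L) (hd' : frameDet a b d ∈ L) :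
    sqDist c d ∈ L := by
  rw [← mul_div_cancel_left₀ (sqDist c d) h0, sqDist_mul_sqDist]
  exact div_mem (add_mem (pow_mem (sub_mem hc hd) 2) (pow_mem (sub_mem hc' hd') 2)) hab

/-- A framework is solvable if and only if all pairwise squared distances are obtained from the
squared edge lengths by `P`-roots. For the construction of a congruent realisation, move two vertices
to `(0, 0)` and `(l, 0)`; then all coordinates arise from the squared distances by square roots. -/
theorem solvableFramework_iff {V : Type*} [Finite V] {P : ℕ → Prop} (h2 : P 2)
    {G : SimpleGraph V} {p : V → Fin 2 → ℂ} {a b : V} (h0 : sqDist (p a) (p b) ≠ 0) :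
    SolvableFramework P G p ↔ ∀ u v, sqDist (p u) (p v) ∈ radClosure P (edgeField G p) := by
  have hfin : ∀ q : V → Fin 2 → ℂ, {z | ∃ (v : V) (i : Fin 2), z = q v i}.Finite := fun q =>
    (Set.finite_range fun i : V × Fin 2 => q i.1 i.2).subset
      (by rintro _ ⟨v, i, rfl⟩; exact ⟨(v, i), rfl⟩)
  have hedge : ∀ q, Congruent p q → edgeField G q = edgeField G p := fun q hq => by
    simp only [edgeField, fun u v => (hq u v).symm]
  constructor
  · rintro ⟨q, hq, -, hM⟩ u v
    have h := (exists_isRootTower_adjoin_le_iff (hfin q)).1 hM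
    rw [hq u v, ← hedge q hq]
    exact sqDist_mem (fun i => h ⟨u, i, rfl⟩) (fun i => h ⟨v, i, rfl⟩)
  · intro h
    obtain ⟨l, hl⟩ := IsAlgClosed.exists_pow_nat_eq (sqDist (p a) (p b)) two_pos
    have hl0 : l ≠ 0 := by rintro rfl; exact h0 (by rw [← hl]; simp)
    have hlmem : l ∈ radClosure P (edgeField G p) :=
      isRootClosed_radClosure _ l 2 h2 (hl ▸ h a b)
    let q : V → Fin 2 → ℂ := fun v =>
      ![frameInner (p a) (p b) (p v) / l, frameDet (p a) (p b) (p v) / l]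
    have hq : Congruent p q := by
      intro u v
      refine mul_left_cancel₀ h0 ?_
      rw [sqDist_mul_sqDist, ← hl]
      simp only [sqDist, q, Matrix.cons_val_zero, Matrix.cons_val_one]
      field_simp
    refine ⟨q, hq, ?_, ?_⟩
    · refine IntermediateField.adjoin_le_iff.2 ?_
      rintro _ ⟨u, v, -, rfl⟩
      exact sqDist_mem (fun i => IntermediateField.subset_adjoin _ _ ⟨u, i, rfl⟩)
        (fun i => IntermediateField.subset_adjoin _ _ ⟨v, i, rfl⟩)
    · rw [hedge q hq]
      refine (exists_isRootTower_adjoin_le_iff (hfin q)).2 ?_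
      rintro _ ⟨v, i, rfl⟩
      fin_cases i
      · exact div_mem (frameInner_mem (h a b) (h a v) (h b v)) hlmem
      · exact div_mem (frameDet_mem h2 (isRootClosed_radClosure _) (h a b) (h a v) (h b v)) hlmem

theorem solvableFramework_coe_iff {W : Type*} {P : ℕ → Prop} (h2 : P 2)
    {H : (⊤ : SimpleGraph W).Subgraph} (hfin : H.verts.Finite) {p : W → Fin 2 → ℂ} {a b : W}
    (ha : a ∈ H.verts) (hb : b ∈ H.verts) (h0 : sqDist (p a) (p b) ≠ 0) :
    SolvableFramework P H.coe (fun v => p v) ↔ ∀ v ∈ H.verts, ∀ w ∈ H.verts,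
      sqDist (p v) (p w) ∈ radClosure P (edgeField H.coe fun v => p v) := by
  have := hfin.to_subtype
  rw [solvableFramework_iff h2 (p := fun v : H.verts => p v) (a := ⟨a, ha⟩) (b := ⟨b, hb⟩) h0]
  simp only [Subtype.forall]

/-- If the disjoint union of the families `x` and `y` is algebraically independent, then `x` is
algebraically independent over the algebraic closure of `ℚ(y)`. -/
theorem exists_isRootClosed_algebraicIndependent {ι κ : Type*} {x : ι → ℂ} {y : κ → ℂ}
    (h : AlgebraicIndependent ℚ (Sum.elim x y)) :
    ∃ A : IntermediateField ℚ ℂ, (∀ j, y j ∈ A) ∧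
      (∀ P : ℕ → Prop, (∀ n, P n → 0 < n) → IsRootClosed P A) ∧ AlgebraicIndependent A x := by
  let R := Algebra.adjoin ℚ (Set.range y)
  have hx : AlgebraicIndependent R x := (AlgebraicIndependent.sumElim_iff.1 h).2
  let A : IntermediateField ℚ ℂ :=
    { (Subalgebra.algebraicClosure R ℂ).restrictScalars ℚ with
      inv_mem' := fun x hx => IsAlgebraic.inv hx }
  refine ⟨A, fun j => ?_, fun P hP z n hn hz => IsAlgebraic.of_pow (hP n hn) hz,
    hx.subalgebraAlgebraicClosure⟩
  exact (Subalgebra.algebraicClosure R ℂ).algebraMap_mem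
    ⟨y j, Algebra.subset_adjoin ⟨j, rfl⟩⟩

open MvPolynomial (C X C_pow C_add C_mul C_1 aeval aeval_X aeval_C algebraMap_eq
  algebraicIndependent_X) in
/-- Passing to coordinates relative to two fixed points is an invertible affine transformation, so
it preserves algebraic independence. -/
theorem algebraicIndependent_frame {A K κ : Type*} [Field A] [Field K] [Algebra A K]
    {a b : Fin 2 → A} (h0 : sqDist a b ≠ 0) {p : κ → Fin 2 → K}
    (hp : AlgebraicIndependent A fun i : κ × Fin 2 => p i.1 i.2) :
    AlgebraicIndependent A fun i : κ × Fin 2 =>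
      ![frameInner (algebraMap A K ∘ a) (algebraMap A K ∘ b) (p i.1),
        frameDet (algebraMap A K ∘ a) (algebraMap A K ∘ b) (p i.1)] i.2 := by
  let e := b 0 - a 0
  let e' := b 1 - a 1
  -- the coordinate change and its inverse, as families of polynomials
  let f : κ × Fin 2 → MvPolynomial (κ × Fin 2) A := fun i =>
    ![C e * (X (i.1, 0) - C (a 0)) + C e' * (X (i.1, 1) - C (a 1)),
      C e * (X (i.1, 1) - C (a 1)) - C e' * (X (i.1, 0) - C (a 0))] i.2
  let g : κ × Fin 2 → MvPolynomial (κ × Fin 2) A := fun i =>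
    ![C (a 0) + C (sqDist a b)⁻¹ * (C e * X (i.1, 0) - C e' * X (i.1, 1)),
      C (a 1) + C (sqDist a b)⁻¹ * (C e' * X (i.1, 0) + C e * X (i.1, 1))] i.2
  have hL : (C (sqDist a b)⁻¹ * (C e ^ 2 + C e' ^ 2) : MvPolynomial (κ × Fin 2) A) = 1 := by
    have h : e ^ 2 + e' ^ 2 = sqDist a b := by simp only [e, e', sqDist]; ring
    rw [← C_pow, ← C_pow, ← C_add, ← C_mul, h, inv_mul_cancel₀ h0, C_1]
  have hgf : (fun i => aeval g (f i)) = X := by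
    ext1 ⟨w, i⟩
    fin_cases i <;>
      simp only [f, g, Fin.zero_eta, Fin.mk_one, Matrix.cons_val_zero, Matrix.cons_val_one, map_add,
        map_sub, map_mul, aeval_X, aeval_C, algebraMap_eq]
    · linear_combination X (w, 0) * hL
    · linear_combination X (w, 1) * hL
  have hf : AlgebraicIndependent A f :=
    AlgebraicIndependent.of_aeval (x := g) (hgf ▸ algebraicIndependent_X _ A)
  convert hp.aeval_of_algebraicIndependent hf using 2 with i
  obtain ⟨w, i⟩ := i
  fin_cases i <;> simp [f, e, e', frameInner, frameDet]

/-- In a solvable graph `H₀ ∪ H₁`, the part `H₁` may be replaced by any solvable graph `H₂` that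
contains `V(H₀) ∩ V(H₁)`, provided that this set has at least two elements `a` and `b`.

Let `C` be the closure under roots of the field of edge lengths of `H₀ ∪ H₂`. It contains the
distances within `H₂`, so the coordinates of `V(H₀) ∩ V(H₁)` relative to `a` and `b`. The relative
coordinates `ξ` of the other vertices of `H₁` are algebraically independent over a field that
contains `C` and the realisation of `H₀`. The distances within `H₀` are obtained by roots from
`C(ξ)`, hence lie in `C`. -/
theorem solvableFramework_sup_coe {W : Type*} {P : ℕ → Prop} (h2 : P 2) (hP : ∀ n, P n → 0 < n)
    {H₀ H₁ H₂ : (⊤ : SimpleGraph W).Subgraph} (hfin₀ : H₀.verts.Finite)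
    (hfin₁ : H₁.verts.Finite) (hfin₂ : H₂.verts.Finite) (hV : H₀.verts ∩ H₁.verts ⊆ H₂.verts)
    {a b : W} (hab : a ≠ b) (ha₀ : a ∈ H₀.verts) (hb₀ : b ∈ H₀.verts) (ha₁ : a ∈ H₁.verts)
    (hb₁ : b ∈ H₁.verts)
    (hG₁ : ∀ p : (H₀ ⊔ H₁).verts → Fin 2 → ℂ, IsGeneric p → SolvableFramework P (H₀ ⊔ H₁).coe p)
    (hH₂ : ∀ p : H₂.verts → Fin 2 → ℂ, IsGeneric p → SolvableFramework P H₂.coe p)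
    {p : (H₀ ⊔ H₂).verts → Fin 2 → ℂ} (hp : IsGeneric p) :
    SolvableFramework P (H₀ ⊔ H₂).coe p := by
  have hS : (H₀ ⊔ H₂).verts.Finite := hfin₀.union hfin₂
  have hS₁ : (H₀ ⊔ H₁).verts.Finite := hfin₀.union hfin₁
  have : Uncountable ℂ := Complex.ofReal_injective.uncountable
  obtain ⟨p, rfl, hp'⟩ := exists_isGeneric_extension hS hfin₁ hp
  have ha : a ∈ (H₀ ⊔ H₂).verts := .inl ha₀
  have hb : b ∈ (H₀ ⊔ H₂).verts := .inl hb₀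
  have ha₂ : a ∈ H₂.verts := hV ⟨ha₀, ha₁⟩
  have hb₂ : b ∈ H₂.verts := hV ⟨hb₀, hb₁⟩
  have hL : sqDist (p a) (p b) ≠ 0 :=
    hp.sqDist_ne_zero (u := ⟨a, ha⟩) (v := ⟨b, hb⟩) (by simpa using hab)
  have hg₁ : IsGeneric fun v : (H₀ ⊔ H₁).verts => p v :=
    hp'.mono (Set.union_subset (fun v hv => .inl (.inl hv)) Set.subset_union_right)
  have hg₂ : IsGeneric fun v : H₂.verts => p v := hp.mono Set.subset_union_right
  have h₁ := (solvableFramework_coe_iff h2 hS₁ (.inl ha₀) (.inl hb₀) hL).1 (hG₁ _ hg₁)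
  have h₂ := (solvableFramework_coe_iff h2 hfin₂ ha₂ hb₂ hL).1 (hH₂ _ hg₂)
  rw [solvableFramework_coe_iff h2 hS ha hb hL]
  set K := edgeField (H₀ ⊔ H₂).coe fun v => p v with hK
  set C := radClosure P K with hCdef
  have hC : IsRootClosed P C := isRootClosed_radClosure K
  have hK_of_adj : ∀ v w, (H₀ ⊔ H₂).Adj v w → sqDist (p v) (p w) ∈ K := fun v w hvw =>
    IntermediateField.subset_adjoin _ _ ⟨⟨v, hvw.fst_mem⟩, ⟨w, hvw.snd_mem⟩, hvw, rfl⟩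
  have hC₂ : ∀ v ∈ H₂.verts, ∀ w ∈ H₂.verts, sqDist (p v) (p w) ∈ C := by
    intro v hv w hw
    refine radClosure_mono (IntermediateField.adjoin_le_iff.2 ?_) (h₂ v hv w hw)
    rintro _ ⟨v, w, hvw, rfl⟩
    exact hK_of_adj v w (.inr hvw)
  have hLC := hC₂ a ha₂ b hb₂
  have hI₂ : ∀ v ∈ H₂.verts, frameInner (p a) (p b) (p v) ∈ C := fun v hv =>
    frameInner_mem hLC (hC₂ a ha₂ v hv) (hC₂ b hb₂ v hv)
  have hD₂ : ∀ v ∈ H₂.verts, frameDet (p a) (p b) (p v) ∈ C := fun v hv =>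
    frameDet_mem h2 hC hLC (hC₂ a ha₂ v hv) (hC₂ b hb₂ v hv)
  -- the vertices of `H₁` outside `H₀ ∪ H₂`, and their relative coordinates
  let T : Set W := H₁.verts \ (H₀ ⊔ H₂).verts
  let e : (T × Fin 2) ⊕ ((H₀ ⊔ H₂).verts × Fin 2) → ↥((H₀ ⊔ H₂).verts ∪ H₁.verts) × Fin 2 :=
    Sum.elim (fun i => (⟨i.1, .inr i.1.2.1⟩, i.2)) (fun i => (⟨i.1, .inl i.1.2⟩, i.2))
  have he : Function.Injective e := by
    rintro (⟨⟨v, hv⟩, i⟩ | ⟨⟨v, hv⟩, i⟩) (⟨⟨w, hw⟩, j⟩ | ⟨⟨w, hw⟩, j⟩) h <;>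
      obtain rfl : v = w := congrArg (fun i => (i.1 : W)) h <;>
      obtain rfl : i = j := congrArg Prod.snd h
    · rfl
    · exact absurd hw hv.2
    · exact absurd hv hw.2
    · rfl
  have hsum : AlgebraicIndependent ℚ (Sum.elim (fun i : T × Fin 2 => p i.1 i.2)
      fun i : (H₀ ⊔ H₂).verts × Fin 2 => p i.1 i.2) := by
    have h := AlgebraicIndependent.comp hp' e he
    rwa [show (fun i : ↥((H₀ ⊔ H₂).verts ∪ H₁.verts) × Fin 2 => p i.1 i.2) ∘ e = Sum.elim
      (fun i : T × Fin 2 => p i.1 i.2) fun i : (H₀ ⊔ H₂).verts × Fin 2 => p i.1 i.2 from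
      funext (Sum.rec (fun _ => rfl) fun _ => rfl)] at h
  obtain ⟨A, hpA, hAclosed, hxA⟩ := exists_isRootClosed_algebraicIndependent hsum
  have hA : ∀ v ∈ (H₀ ⊔ H₂).verts, ∀ i, p v i ∈ A := fun v hv i => hpA (⟨v, hv⟩, i)
  have hCA : C ≤ A := by
    refine radClosure_le (IntermediateField.adjoin_le_iff.2 ?_) (hAclosed P hP)
    rintro _ ⟨v, w, -, rfl⟩
    exact sqDist_mem (hA v v.2) (hA w w.2)
  let ξ : T × Fin 2 → ℂ := fun i =>
    ![frameInner (p a) (p b) (p i.1), frameDet (p a) (p b) (p i.1)] i.2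
  have hξ : AlgebraicIndependent A ξ := by
    let a' : Fin 2 → A := fun i => ⟨p a i, hA a ha i⟩
    let b' : Fin 2 → A := fun i => ⟨p b i, hA b hb i⟩
    have h0 : sqDist a' b' ≠ 0 := fun h => hL (congrArg (algebraMap A ℂ) h)
    exact algebraicIndependent_frame (p := fun (v : T) => p v) h0 hxA
  set E := C ⊔ IntermediateField.adjoin ℚ (Set.range ξ) with hE
  have hCE : C ≤ E := le_sup_left
  have hξE : ∀ i, ξ i ∈ E := fun i =>
    (le_sup_right : _ ≤ E) (IntermediateField.subset_adjoin _ _ ⟨i, rfl⟩)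
  have hfr : ∀ v ∈ H₁.verts,
      frameInner (p a) (p b) (p v) ∈ E ∧ frameDet (p a) (p b) (p v) ∈ E := by
    intro v hv
    by_cases hvS : v ∈ (H₀ ⊔ H₂).verts
    · have hv₂ : v ∈ H₂.verts := hvS.elim (fun h => hV ⟨h, hv⟩) id
      exact ⟨hCE (hI₂ v hv₂), hCE (hD₂ v hv₂)⟩
    · exact ⟨hξE (⟨v, hv, hvS⟩, 0), hξE (⟨v, hv, hvS⟩, 1)⟩
  have hedge₁ : edgeField (H₀ ⊔ H₁).coe (fun v => p v) ≤ E := by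
    refine IntermediateField.adjoin_le_iff.2 ?_
    rintro _ ⟨v, w, hvw | hvw, rfl⟩
    · exact hCE (le_radClosure K (hK_of_adj v w (.inl hvw)))
    · have hv := hfr v hvw.fst_mem
      have hw := hfr w hvw.snd_mem
      exact sqDist_mem_of_frame_mem hL (hCE hLC) hv.1 hv.2 hw.1 hw.2
  have hC₀ : ∀ v ∈ H₀.verts, ∀ w ∈ H₀.verts, sqDist (p v) (p w) ∈ C := fun v hv w hw =>
    mem_of_mem_radClosure_sup_adjoin hP hCA hC hξ
      (sqDist_mem (hA v (.inl hv)) (hA w (.inl hw)))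
      (radClosure_mono hedge₁ (h₁ v (.inl hv) w (.inl hw)))
  have hfrC : ∀ v ∈ (H₀ ⊔ H₂).verts,
      frameInner (p a) (p b) (p v) ∈ C ∧ frameDet (p a) (p b) (p v) ∈ C := by
    rintro v (hv | hv)
    · exact ⟨frameInner_mem hLC (hC₀ a ha₀ v hv) (hC₀ b hb₀ v hv),
        frameDet_mem h2 hC hLC (hC₀ a ha₀ v hv) (hC₀ b hb₀ v hv)⟩
    · exact ⟨hI₂ v hv, hD₂ v hv⟩
  intro v hv w hw
  exact sqDist_mem_of_frame_mem hL hLC (hfrC v hv).1 (hfrC v hv).2 (hfrC w hw).1 (hfrC w hw).2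

end Solvability

end Framework

/-- The graphs `H₀, H₁, H₂` are finite simple graphs with vertices in a common type `W`, that is,
subgraphs of the complete graph on `W`; `⊔` is the union of graphs, and `H.coe` is `H` as a graph
on its own vertex set. -/
theorem lemma6 {W : Type*} (H₀ H₁ H₂ : (⊤ : SimpleGraph W).Subgraph) (U : Set W)
    (hfin₀ : H₀.verts.Finite) (hfin₁ : H₁.verts.Finite) (hfin₂ : H₂.verts.Finite)
    (hV₀₁ : H₀.verts ∩ H₁.verts = U) (hV₀₂ : H₀.verts ∩ H₂.verts = U)
    (hV₁₂ : H₁.verts ∩ H₂.verts = U) (hU : 2 ≤ U.ncard)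
    (hE₀₁ : H₀.edgeSet ∩ H₁.edgeSet = ∅) (hE₀₂ : H₀.edgeSet ∩ H₂.edgeSet = ∅)
    (hG₁ : Framework.IsRigid (H₀ ⊔ H₁).coe) (hH₂ : Framework.IsRigid H₂.coe) :
    Framework.IsRigid (H₀ ⊔ H₂).coe ∧
    (Framework.IsRadicallySolvable (H₀ ⊔ H₁).coe → Framework.IsRadicallySolvable H₂.coe →
      Framework.IsRadicallySolvable (H₀ ⊔ H₂).coe) ∧
    (Framework.IsQuadraticallySolvable (H₀ ⊔ H₁).coe →
      Framework.IsQuadraticallySolvable H₂.coe →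
      Framework.IsQuadraticallySolvable (H₀ ⊔ H₂).coe) := by
  have hUfin : U.Finite := hV₀₁ ▸ hfin₀.inter_of_left _
  obtain ⟨a, b, ha, hb, hab⟩ := (Set.one_lt_ncard_iff hUfin).1 hU
  have hV : H₀.verts ∩ H₁.verts ⊆ H₂.verts := by
    rw [hV₀₁, ← hV₀₂]
    exact Set.inter_subset_right
  rw [← hV₀₁] at ha hb
  have hrigid : Framework.IsRigid (H₀ ⊔ H₂).coe :=
    Framework.isRigid_sup_coe hfin₀ hfin₁ hfin₂ hV hab ha.1 hb.1 ha.2 hb.2 hG₁ hH₂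
  refine ⟨hrigid, fun hs₁ hs₂ => ⟨hrigid, fun p hp => ?_⟩, fun hs₁ hs₂ => ⟨hrigid, fun p hp => ?_⟩⟩
  · exact Framework.solvableFramework_sup_coe (P := fun n => 0 < n) two_pos (fun _ h => h)
      hfin₀ hfin₁ hfin₂ hV hab ha.1 hb.1 ha.2 hb.2 hs₁.2 hs₂.2 hp
  · exact Framework.solvableFramework_sup_coe (P := fun n => n = 2) rfl (fun _ h => h ▸ two_pos)
      hfin₀ hfin₁ hfin₂ hV hab ha.1 hb.1 ha.2 hb.2 hs₁.2 hs₂.2 hp
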